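/- Let $n\ge 3$, let $(N,g_N)$ be a smooth Riemannian manifold of dimension $n-1$ (without boundary), let $\bar r\in(0,\infty]$, and let $h:(-\bar r,\bar r)\to(0,\infty)$ be smooth. Equip $M=N\times(-\bar r,\bar r)$ with the warped product metric $g=dr\otimes dr+h(r)^2g_N$ and put $\mathbf n=\partial/\partial r$. For a smooth immersed hypersurface $F:S\to M$, where $S$ is a smooth $(n-1)$-manifold, with unit normal field $\nu$, let $u=r\circ F$ be its height function (the signed distance to $N\times\{0\}$), $\Theta=\langle\mathbf n,\nu\rangle$ its angle function, $\Delta$ the Laplace operator of the induced metric, and $H$ the mean curvature with respect to $\nu$, that is, the trace (with respect to the induced metric) of the second fundamental form $A(X,Y)=\langle\bar\nabla_X\nu,Y\rangle=-\langle\bar\nabla_XY,\nu\rangle$, where $\bar\nabla$ is the Levi-Civita connection of $g$. (1) For every such hypersurface, everywhere on $S$, $$\Delta u=\frac{h'(u)}{h(u)}\,(n-2+\Theta^2)-H\Theta .$$ (2) Let $F(\cdot,t):S\to M$, $t\in[0,T)$, $0<T\le\infty$, be a mean curvature flow, that is, each $F(\cdot,t)$ is a smooth immersed hypersurface with unit normal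 field $\nu(\cdot,t)$ and mean curvature $H(\cdot,t)$, and $\partial F/\partial t=-H\nu$ (with the one-sided derivative at $t=0$). Then the height function $u(x,t)=r(F(x,t))$ is differentiable in $t$, and on $S\times[0,T)$ $$\frac{\partial u}{\partial t}=-H\Theta,\qquad \frac{\partial u}{\partial t}-\Delta u=-\frac{h'(u)}{h(u)}\,(n-2+\Theta^2).$$ -/

import Mathlib

open Set Manifold
open scoped ContDiff

noncomputable section

namespace WarpedFlow

/-! ### Coordinate formulas on a finite-dimensional vector space -/

section Coordinates

variable {V : Type*} [NormedAddCommGroup V] [NormedSpace ℝ V] [FiniteDimensional ℝ V]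

/-- The inverse Gram matrix `g^{ij}` of a bilinear form `B`, with respect to a fixed basis of `V`.
All quantities below that use it are traces, hence independent of the basis. -/
def invGram (B : V →L[ℝ] V →L[ℝ] ℝ) :
    Matrix (Fin (Module.finrank ℝ V)) (Fin (Module.finrank ℝ V)) ℝ :=
  (Matrix.of fun i j => B (Module.finBasis ℝ V i) (Module.finBasis ℝ V j))⁻¹

/-- The trace `∑ g^{ij} Q(b_i, b_j)` of `Q` with respect to the inner product `B`. -/
def traceWith (B : V →L[ℝ] V →L[ℝ] ℝ) (Q : V → V → ℝ) : ℝ :=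
  ∑ i, ∑ j, invGram B i j * Q (Module.finBasis ℝ V i) (Module.finBasis ℝ V j)

/-- Christoffel symbols of the first kind of the metric `G` at `p`:
`½ (D_v G(w, z) + D_w G(v, z) - D_z G(v, w))`. -/
def christoffelFirst (G : V → V →L[ℝ] V →L[ℝ] ℝ) (p v w z : V) : ℝ :=
  (1 / 2) * (fderiv ℝ G p v w z + fderiv ℝ G p w v z - fderiv ℝ G p z v w)

/-- Christoffel symbols `Γ(v, w) = Γ^k_{ij} v^i w^j b_k` of the Levi-Civita connection of `G`
at `p`; that connection is `∇_v Y = DY(v) + Γ(v, Y)`. -/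
def christoffel (G : V → V →L[ℝ] V →L[ℝ] ℝ) (p v w : V) : V :=
  ∑ k, ∑ l, (invGram (G p) k l * christoffelFirst G p v w (Module.finBasis ℝ V l)) •
    Module.finBasis ℝ V k

end Coordinates

/-! ### Metrics, Laplace operator and mean curvature on manifolds -/

section Manifolds

variable {V : Type*} [NormedAddCommGroup V] [NormedSpace ℝ V]
  {H : Type*} [TopologicalSpace H]
  {W : Type*} [NormedAddCommGroup W] [NormedSpace ℝ W]
  {K : Type*} [TopologicalSpace K]

/-- A field of bilinear forms on the tangent spaces of `X` (a covariant 2-tensor field). -/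
abbrev BilinField (I : ModelWithCorners ℝ V H) (X : Type*) [TopologicalSpace X]
    [ChartedSpace H X] : Type _ :=
  ∀ x : X, TangentSpace I x →L[ℝ] TangentSpace I x →L[ℝ] ℝ

/-- The pullback `(f^* g)_x(v, w) = g_{f x}(df v, df w)`. -/
def pullback (I : ModelWithCorners ℝ V H) {X : Type*} [TopologicalSpace X] [ChartedSpace H X]
    (J : ModelWithCorners ℝ W K) {Y : Type*} [TopologicalSpace Y] [ChartedSpace K Y]
    (f : X → Y) (g : BilinField J Y) : BilinField I X := fun x =>
  let B : W →L[ℝ] W →L[ℝ] ℝ := g (f x)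
  let A : V →L[ℝ] W := mfderiv I J f x
  ContinuousLinearMap.bilinearComp (E := W) (F := W) (E' := V) (F' := V) B A A

/-- The expression of the metric `g` in the chart of `X` around `x₀`
(manifolds without boundary). -/
def inChart (I : ModelWithCorners ℝ V H) {X : Type*} [TopologicalSpace X] [ChartedSpace H X]
    (g : BilinField I X) (x₀ : X) : V → V →L[ℝ] V →L[ℝ] ℝ :=
  pullback 𝓘(ℝ, V) I (extChartAt I x₀).symm g

/-- The Laplace(-Beltrami) operator of the metric `g`: the trace
`g^{ij} (∂_i ∂_j u - Γ^k_{ij} ∂_k u)` of the covariant Hessian, computed at `x` in the chart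
around `x`. -/
def laplacian [FiniteDimensional ℝ V] (I : ModelWithCorners ℝ V H) {X : Type*}
    [TopologicalSpace X] [ChartedSpace H X]
    (g : BilinField I X) (u : X → ℝ) (x : X) : ℝ :=
  let p : V := extChartAt I x x
  let G : V → V →L[ℝ] V →L[ℝ] ℝ := inChart I g x
  let w : V → ℝ := u ∘ (extChartAt I x).symm
  traceWith (G p) fun a b => fderiv ℝ (fderiv ℝ w) p a b - fderiv ℝ w p (christoffel G p a b)

/-- The second fundamental form of the hypersurface `F : X → Y` at `x` with respect to the unit
normal `ν ∈ T_{F x} Y`, in the charts around `x` and `F x`: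
`A(a, b) = -⟨∇̄_a (dF b), ν⟩ = -⟨D²f(a, b) + Γ̄(Df a, Df b), ν⟩`, where `f` is `F` in the charts.
(For a normal field `ν` this is `⟨∇̄_a ν, dF b⟩`.) -/
def secondFundamentalForm [FiniteDimensional ℝ W] (I : ModelWithCorners ℝ V H) {X : Type*}
    [TopologicalSpace X] [ChartedSpace H X] (J : ModelWithCorners ℝ W K) {Y : Type*}
    [TopologicalSpace Y] [ChartedSpace K Y] (g : BilinField J Y)
    (F : X → Y) (x : X) (ν : TangentSpace J (F x)) (a b : V) : ℝ :=
  let p : V := extChartAt I x x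
  let q : W := extChartAt J (F x) (F x)
  let G : W → W →L[ℝ] W →L[ℝ] ℝ := inChart J g (F x)
  let f : V → W := extChartAt J (F x) ∘ F ∘ (extChartAt I x).symm
  let n : W := mfderiv J 𝓘(ℝ, W) (extChartAt J (F x)) (F x) ν;
  -(G q (fderiv ℝ (fderiv ℝ f) p a b + christoffel G q (fderiv ℝ f p a) (fderiv ℝ f p b)) n)

/-- The mean curvature: the trace `g^{ij} A_{ij}` of the second fundamental form with respect to
the induced metric. -/
def meanCurvature [FiniteDimensional ℝ V] [FiniteDimensional ℝ W] (I : ModelWithCorners ℝ V H)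
    {X : Type*} [TopologicalSpace X] [ChartedSpace H X] (J : ModelWithCorners ℝ W K) {Y : Type*}
    [TopologicalSpace Y] [ChartedSpace K Y] (g : BilinField J Y)
    (F : X → Y) (x : X) (ν : TangentSpace J (F x)) : ℝ :=
  traceWith (inChart I (pullback I J F g) x (extChartAt I x x))
    (secondFundamentalForm I J g F x ν)

/-- `ν` is a unit normal field along the map `F`. -/
def IsUnitNormal (I : ModelWithCorners ℝ V H) {X : Type*} [TopologicalSpace X] [ChartedSpace H X]
    (J : ModelWithCorners ℝ W K) {Y : Type*} [TopologicalSpace Y] [ChartedSpace K Y]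
    (g : BilinField J Y) (F : X → Y) (ν : ∀ x, TangentSpace J (F x)) : Prop :=
  ∀ x, g (F x) (ν x) (ν x) = 1 ∧
    ∀ v : TangentSpace I x, g (F x) (ν x) (mfderiv I J F x v) = 0

end Manifolds

/-! ### Warped products and their hypersurfaces -/

/-- The model space of `(n-1)`-dimensional manifolds. -/
abbrev E (n : ℕ) : Type := EuclideanSpace ℝ (Fin (n - 1))

/-- The model of the `n`-dimensional product manifold `N × ℝ`. -/
abbrev IM (n : ℕ) : ModelWithCorners ℝ (E n × ℝ) (ModelProd (E n) ℝ) :=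
  𝓘(ℝ, E n).prod 𝓘(ℝ, ℝ)

/-- The interval `(-r̄, r̄)`, where `r̄` may be `∞`. -/
def radialInterval (rbar : EReal) : Set ℝ := {r | ((|r| : ℝ) : EReal) < rbar}

/-- The time interval `[0, T)`, where `T` may be `∞`. -/
def timeInterval (T : EReal) : Set ℝ := {t | 0 ≤ t ∧ (t : EReal) < T}

section Warped

variable {n : ℕ}
  {N : Type*} [TopologicalSpace N] [ChartedSpace (E n) N] [IsManifold 𝓘(ℝ, E n) ∞ N]
  {S : Type*} [TopologicalSpace S] [ChartedSpace (E n) S]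

/-- The standard metric `dr ⊗ dr` of the real line. -/
def lineMetric : BilinField 𝓘(ℝ, ℝ) ℝ := fun _ => ContinuousLinearMap.mul ℝ ℝ

/-- The warped product metric `dr ⊗ dr + h(r)² g_N` on `N × ℝ`; it is used on the open set
`N × (-r̄, r̄)`, where `h` is smooth and positive. -/
def warpedMetric (gN : Bundle.ContMDiffRiemannianMetric 𝓘(ℝ, E n) ∞ (E n)
      (fun y : N => TangentSpace 𝓘(ℝ, E n) y)) (h : ℝ → ℝ) : BilinField (IM n) (N × ℝ) :=
  fun p => pullback (IM n) 𝓘(ℝ, ℝ) Prod.snd lineMetric p +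
    h p.2 ^ 2 • pullback (IM n) 𝓘(ℝ, E n) Prod.fst gN.inner p

/-- The radial vector field `𝐧 = ∂/∂r` on `N × ℝ`. -/
def radialField (p : N × ℝ) : TangentSpace (IM n) p := ((0 : E n), (1 : ℝ))

/-- `F : S → N × (-r̄, r̄)` is a smooth immersed hypersurface. -/
structure IsHypersurface (rbar : EReal) (F : S → N × ℝ) : Prop where
  smooth : ContMDiff 𝓘(ℝ, E n) (IM n) ∞ F
  immersion : ∀ x, Function.Injective (mfderiv 𝓘(ℝ, E n) (IM n) F x)
  mem : ∀ x, (F x).2 ∈ radialInterval rbar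

/-- The height function `u = r ∘ F`: the signed distance to the slice `N × {0}`. -/
def height (F : S → N × ℝ) (x : S) : ℝ := (F x).2

/-- The angle function `Θ = ⟨𝐧, ν⟩`. -/
def angle (g : BilinField (IM n) (N × ℝ)) (F : S → N × ℝ)
    (ν : ∀ x, TangentSpace (IM n) (F x)) (x : S) : ℝ :=
  g (F x) (radialField (F x)) (ν x)

/-- Mean curvature flow `∂F/∂t = -H ν` in `N × (-r̄, r̄)` on the time interval `[0, T)`, through
smooth immersed hypersurfaces `F t` with unit normals `ν t` (the time derivative is one-sided at
`t = 0`). -/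
structure IsMeanCurvatureFlow (rbar : EReal) (g : BilinField (IM n) (N × ℝ)) (T : EReal)
    (F : ℝ → S → N × ℝ) (ν : ∀ t x, TangentSpace (IM n) (F t x)) : Prop where
  hypersurface : ∀ t ∈ timeInterval T, IsHypersurface (n := n) rbar (F t)
  normal : ∀ t ∈ timeInterval T, IsUnitNormal 𝓘(ℝ, E n) (IM n) g (F t) (ν t)
  evolution : ∀ t ∈ timeInterval T, ∀ x,
    HasMFDerivWithinAt 𝓘(ℝ, ℝ) (IM n) (fun s => F s x) (timeInterval T) t
      (ContinuousLinearMap.toSpanSingleton ℝ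
        (-(meanCurvature 𝓘(ℝ, E n) (IM n) g (F t) x (ν t x)) • ν t x))

end Warped

end WarpedFlow

end

open scoped Topology

/-! The height is the restriction of the function r, and in a warped product `Hess r = (h'/h)(g - dr
⊗ dr)`. Restricting a function to a hypersurface adds to its Hessian the normal part of the second
derivative of F paired with dr, so by the Gauss formula `Hess u = (h'/h)(g - du ⊗ du) - Θ A`, with g
now the induced metric. Its trace gives (1): `tr g = n - 1`, `tr A = H`, and `|du|² = 1 - Θ²`
because the gradient of u is the tangential part of 𝐧. For (2), applying dr to the velocity `-Hν`
gives `∂u/∂t = -HΘ`, and subtracting (1) cancels the curvature terms.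

The computation lives in `traceWith_hessian_height`, in coordinates. It rests on
`christoffelFirst_bilinearComp` (Gauss formula), `christoffelFirst_warpedModel` (Hessian of r) and
the trace identities. `inChart_pullback`, `inChart_extChartAt_self`, `differentiableAt_inChart` and
`inChart_warpedMetric` carry it to manifolds. -/

namespace WarpedFlow

/-! ### Traces and index raising with the inverse Gram matrix. -/

section LinearAlgebra

variable {V : Type*} [NormedAddCommGroup V] [NormedSpace ℝ V] [FiniteDimensional ℝ V]

/-- A kernel vector of the Gram matrix holds the coordinates of some v that pairs to zero with every
basis vector, so `B v v = 0`. -/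
theorem gram_isUnit_det {B : V →L[ℝ] V →L[ℝ] ℝ} (hB : ∀ v, v ≠ 0 → 0 < B v v) :
    IsUnit (Matrix.of fun i j =>
      B (Module.finBasis ℝ V i) (Module.finBasis ℝ V j)).det := by
  rw [isUnit_iff_ne_zero]
  intro h0
  obtain ⟨c, hc, hM⟩ := Matrix.exists_mulVec_eq_zero_iff.2 h0
  set v : V := ∑ j, c j • Module.finBasis ℝ V j with hv
  have hz : ∀ i, B (Module.finBasis ℝ V i) v = 0 := by
    intro i
    have := congrFun hM i
    simp only [Matrix.mulVec, dotProduct, Matrix.of_apply, Pi.zero_apply] at this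
    rw [hv, map_sum, ← this]
    exact Finset.sum_congr rfl fun j _ => by simp [mul_comm]
  have hv0 : v ≠ 0 := by
    intro h
    apply hc
    funext i
    exact linearIndependent_iff'.1 (Module.finBasis ℝ V).linearIndependent Finset.univ c h i
      (Finset.mem_univ i)
  have : B v v = 0 := by
    conv_lhs => arg 1; rw [hv]
    simp only [map_sum, map_smul, sum_apply, smul_apply, hz, smul_zero, Finset.sum_const_zero]
  exact (hB v hv0).ne' this

theorem invGram_mul_gram {B : V →L[ℝ] V →L[ℝ] ℝ} (hB : ∀ v, v ≠ 0 → 0 < B v v)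
    (i k : Fin (Module.finrank ℝ V)) :
    ∑ j, invGram B i j * B (Module.finBasis ℝ V j) (Module.finBasis ℝ V k) =
      if i = k then 1 else 0 := by
  have := congrFun (congrFun (Matrix.nonsing_inv_mul _ (gram_isUnit_det hB)) i) k
  rw [Matrix.mul_apply, Matrix.one_apply] at this
  exact this

theorem traceWith_self {B : V →L[ℝ] V →L[ℝ] ℝ} (hB : ∀ v, v ≠ 0 → 0 < B v v)
    (hs : ∀ v w, B v w = B w v) :
    traceWith B (fun a b => B a b) = Module.finrank ℝ V := by
  have : ∀ i, ∑ j, invGram B i j * B (Module.finBasis ℝ V i) (Module.finBasis ℝ V j) = 1 := by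
    intro i
    simpa [hs (Module.finBasis ℝ V i)] using invGram_mul_gram hB i i
  simp [traceWith, this]

/-- Raising the index of the covector `B t` recovers the components of t. -/
theorem sum_invGram_mul_apply {B : V →L[ℝ] V →L[ℝ] ℝ} (hB : ∀ v, v ≠ 0 → 0 < B v v)
    (hs : ∀ v w, B v w = B w v) (t : V) (i : Fin (Module.finrank ℝ V)) :
    ∑ j, invGram B i j * B t (Module.finBasis ℝ V j) = (Module.finBasis ℝ V).repr t i := by
  have : ∀ j, B t (Module.finBasis ℝ V j) = ∑ k, (Module.finBasis ℝ V).repr t k *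
      B (Module.finBasis ℝ V j) (Module.finBasis ℝ V k) := by
    intro j
    conv_lhs => rw [hs, ← (Module.finBasis ℝ V).sum_repr t]
    simp only [map_sum, map_smul, smul_eq_mul]
  simp_rw [this, Finset.mul_sum]
  rw [Finset.sum_comm]
  simp_rw [mul_left_comm _ ((Module.finBasis ℝ V).repr t _), ← Finset.mul_sum,
    invGram_mul_gram hB]
  simp

/-- Used with t the gradient of the height, where it evaluates the trace of `du ⊗ du`. -/
theorem traceWith_apply_mul_apply {B : V →L[ℝ] V →L[ℝ] ℝ} (hB : ∀ v, v ≠ 0 → 0 < B v v)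
    (hs : ∀ v w, B v w = B w v) (t : V) :
    traceWith B (fun a b => B t a * B t b) = B t t := by
  simp_rw [traceWith, mul_left_comm _ (B t (Module.finBasis ℝ V _)), ← Finset.mul_sum,
    sum_invGram_mul_apply hB hs]
  conv_rhs => rw [← (Module.finBasis ℝ V).sum_repr t]
  rw [map_sum]
  conv_rhs => rw [← (Module.finBasis ℝ V).sum_repr t]
  simp only [map_smul, smul_eq_mul, (Module.finBasis ℝ V).sum_repr t, mul_comm]

theorem traceWith_add (B : V →L[ℝ] V →L[ℝ] ℝ) (Q R : V → V → ℝ) :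
    traceWith B (fun a b => Q a b + R a b) = traceWith B Q + traceWith B R := by
  simp [traceWith, mul_add, Finset.sum_add_distrib]

theorem traceWith_const_mul (B : V →L[ℝ] V →L[ℝ] ℝ) (c : ℝ) (Q : V → V → ℝ) :
    traceWith B (fun a b => c * Q a b) = c * traceWith B Q := by
  simp [traceWith, Finset.mul_sum, mul_left_comm]

/-- Lowering the index undoes the raising in `christoffel`, so later arguments never meet the
inverse Gram matrix outside a trace. -/
theorem apply_christoffel {G : V → V →L[ℝ] V →L[ℝ] ℝ} {p : V}
    (hG : ∀ v, v ≠ 0 → 0 < G p v v) (hs : ∀ v w, G p v w = G p w v) (v w z : V) :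
    G p (christoffel G p v w) z = christoffelFirst G p v w z := by
  have hlin : ∀ c : Fin (Module.finrank ℝ V) → ℝ,
      christoffelFirst G p v w (∑ i, c i • Module.finBasis ℝ V i) =
        ∑ i, c i * christoffelFirst G p v w (Module.finBasis ℝ V i) := by
    intro c
    simp only [christoffelFirst, map_sum, map_smul, sum_apply,
      smul_apply, smul_eq_mul]
    rw [← Finset.sum_add_distrib, ← Finset.sum_sub_distrib, Finset.mul_sum]
    exact Finset.sum_congr rfl fun i _ => by ring
  conv_rhs => rw [← (Module.finBasis ℝ V).sum_repr z, hlin]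
  rw [hs, christoffel, map_sum]
  simp_rw [map_sum, map_smul, smul_eq_mul, ← sum_invGram_mul_apply hG hs z, Finset.sum_mul]
  have hsym : ∀ k l, invGram (G p) k l = invGram (G p) l k := by
    intro k l
    have : (invGram (G p)).transpose = invGram (G p) := by
      rw [invGram, Matrix.transpose_nonsing_inv]
      congr 1
      ext i j
      exact hs _ _
    exact congrFun (congrFun this l) k
  rw [Finset.sum_comm]
  refine Finset.sum_congr rfl fun l _ => Finset.sum_congr rfl fun k _ => ?_
  rw [hsym]
  ring

end LinearAlgebra

/-! ### Derivatives of metric coefficients and of induced metrics. -/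

section Derivatives

variable {X : Type*} [NormedAddCommGroup X] [NormedSpace ℝ X]
  {V : Type*} [NormedAddCommGroup V] [NormedSpace ℝ V]
  {W : Type*} [NormedAddCommGroup W] [NormedSpace ℝ W]

theorem differentiableAt_flip {C : X → V →L[ℝ] W →L[ℝ] ℝ} {x : X}
    (hC : DifferentiableAt ℝ C x) : DifferentiableAt ℝ (fun y => (C y).flip) x :=
  DifferentiableAt.fun_comp' (𝕜 := ℝ) (F := V →L[ℝ] W →L[ℝ] ℝ) (G := W →L[ℝ] V →L[ℝ] ℝ) x
    (g := fun c => c.flip)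
    (ContinuousLinearMap.differentiableAt
      ((ContinuousLinearMap.flipₗᵢ ℝ V W ℝ).toContinuousLinearEquiv :
        (V →L[ℝ] W →L[ℝ] ℝ) →L[ℝ] (W →L[ℝ] V →L[ℝ] ℝ))) hC

theorem differentiableAt_bilinearComp {B : X → W →L[ℝ] W →L[ℝ] ℝ} {A : X → V →L[ℝ] W} {x : X}
    (hB : DifferentiableAt ℝ B x) (hA : DifferentiableAt ℝ A x) :
    DifferentiableAt ℝ (fun y => (B y).bilinearComp (A y) (A y)) x :=
  differentiableAt_flip ((differentiableAt_flip (hB.clm_comp hA)).clm_comp hA)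

theorem differentiableAt_const_add_smul {Y : Type*} [NormedAddCommGroup Y] [NormedSpace ℝ Y]
    {c : X → ℝ} {b : X → Y} {x : X} (a : Y) (hc : DifferentiableAt ℝ c x)
    (hb : DifferentiableAt ℝ b x) : DifferentiableAt ℝ (fun y => a + c y • b y) x :=
  (differentiableAt_const a).add (hc.smul hb)

theorem fderiv_bilinear_apply {B : X → W →L[ℝ] W →L[ℝ] ℝ} {x : X}
    (hB : DifferentiableAt ℝ B x) (a : X) (v w : W) :
    fderiv ℝ B x a v w = fderiv ℝ (fun y => B y v w) x a := by
  have := (hB.hasFDerivAt.clm_apply (hasFDerivAt_const v x)).clm_apply (hasFDerivAt_const w x)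
  rw [this.fderiv]
  simp

/-- The first Christoffel symbols of the metric induced by an immersion `f`. -/
theorem christoffelFirst_bilinearComp {f : V → W} {p : V} (hf : ContDiffAt ℝ 2 f p)
    {G : W → W →L[ℝ] W →L[ℝ] ℝ} (hG : DifferentiableAt ℝ G (f p))
    (hs : ∀ v w, G (f p) v w = G (f p) w v) (a b c : V) :
    christoffelFirst (fun y => (G (f y)).bilinearComp (fderiv ℝ f y) (fderiv ℝ f y)) p a b c =
      G (f p) (fderiv ℝ (fderiv ℝ f) p a b) (fderiv ℝ f p c) +
        christoffelFirst G (f p) (fderiv ℝ f p a) (fderiv ℝ f p b) (fderiv ℝ f p c) := by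
  have hf1 : DifferentiableAt ℝ f p := hf.differentiableAt (by norm_num)
  have hf2 : DifferentiableAt ℝ (fderiv ℝ f) p :=
    (hf.fderiv_right (m := 1) (by norm_num)).differentiableAt (by norm_num)
  have hGf : DifferentiableAt ℝ (fun y => G (f y)) p :=
    DifferentiableAt.fun_comp' (𝕜 := ℝ) (F := W) (G := W →L[ℝ] W →L[ℝ] ℝ) p hG hf1
  have hsymm : ∀ a b, fderiv ℝ (fderiv ℝ f) p a b = fderiv ℝ (fderiv ℝ f) p b a :=
    fun a b => (hf.isSymmSndFDerivAt (by simp)).eq a b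
  have hd : ∀ a b c, fderiv ℝ (fun y => (G (f y)).bilinearComp (fderiv ℝ f y) (fderiv ℝ f y))
      p a b c = fderiv ℝ G (f p) (fderiv ℝ f p a) (fderiv ℝ f p b) (fderiv ℝ f p c) +
        G (f p) (fderiv ℝ (fderiv ℝ f) p a b) (fderiv ℝ f p c) +
        G (f p) (fderiv ℝ f p b) (fderiv ℝ (fderiv ℝ f) p a c) := by
    intro a b c
    rw [fderiv_bilinear_apply (differentiableAt_bilinearComp hGf hf2)]
    have hv : ∀ v, HasFDerivAt (fun y => fderiv ℝ f y v) _ p :=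
      fun v => hf2.hasFDerivAt.clm_apply (hasFDerivAt_const v p)
    have hGc := HasFDerivAt.comp (𝕜 := ℝ) (F := W) (G := W →L[ℝ] W →L[ℝ] ℝ) p
      hG.hasFDerivAt hf1.hasFDerivAt
    have := (hGc.clm_apply (hv b)).clm_apply (hv c)
    have h2 := this.fderiv
    simp only [Function.comp_def] at h2
    simp only [ContinuousLinearMap.bilinearComp_apply]
    rw [h2]
    simp
    ring
  -- In the alternating sum of the three derivatives, symmetry of `D²f` and of G cancels all
  -- second-derivative terms except two equal copies of `G(D²f(a, b), Df c)`.
  simp only [christoffelFirst, hd, hsymm b a, hsymm c a, hsymm c b,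
    hs (fderiv ℝ f p _) (fderiv ℝ (fderiv ℝ f) p _ _)]
  ring

theorem christoffelFirst_congr {G G' : V → V →L[ℝ] V →L[ℝ] ℝ} {p : V} (h : G =ᶠ[𝓝 p] G') :
    christoffelFirst G p = christoffelFirst G' p := by
  funext v w z
  simp only [christoffelFirst, h.fderiv_eq]

end Derivatives

/-! ### The warped product in coordinates. -/

section WarpedModel

variable {V : Type*} [NormedAddCommGroup V] [NormedSpace ℝ V]

/-- The warped product metric `dr ⊗ dr + h(r)² γ` on a product of a vector space with `ℝ`. -/
noncomputable def warpedModel (h : ℝ → ℝ) (γ : V → V →L[ℝ] V →L[ℝ] ℝ) (q : V × ℝ) :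
    V × ℝ →L[ℝ] V × ℝ →L[ℝ] ℝ :=
  (ContinuousLinearMap.mul ℝ ℝ).bilinearComp (ContinuousLinearMap.snd ℝ V ℝ)
      (ContinuousLinearMap.snd ℝ V ℝ) +
    h q.2 ^ 2 • (γ q.1).bilinearComp (ContinuousLinearMap.fst ℝ V ℝ)
      (ContinuousLinearMap.fst ℝ V ℝ)

theorem warpedModel_apply (h : ℝ → ℝ) (γ : V → V →L[ℝ] V →L[ℝ] ℝ) (q v w : V × ℝ) :
    warpedModel h γ q v w = v.2 * w.2 + h q.2 ^ 2 * γ q.1 v.1 w.1 := rfl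

variable {h : ℝ → ℝ} {γ : V → V →L[ℝ] V →L[ℝ] ℝ} {q : V × ℝ}

theorem differentiableAt_warpedModel (hh : DifferentiableAt ℝ h q.2)
    (hγ : DifferentiableAt ℝ γ q.1) : DifferentiableAt ℝ (warpedModel h γ) q := by
  have h1 : DifferentiableAt ℝ (fun q : V × ℝ => h q.2) q := hh.comp q differentiableAt_snd
  have h2 : DifferentiableAt ℝ (fun q : V × ℝ => γ q.1) q :=
    DifferentiableAt.fun_comp' (𝕜 := ℝ) (F := V) (G := V →L[ℝ] V →L[ℝ] ℝ) q hγ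
      differentiableAt_fst
  have h3 := differentiableAt_bilinearComp h2
    (differentiableAt_const (ContinuousLinearMap.fst ℝ V ℝ))
  exact differentiableAt_const_add_smul (Y := V × ℝ →L[ℝ] V × ℝ →L[ℝ] ℝ) _ (h1.pow 2) h3

/-- The radial component of the first Christoffel symbols of a warped product. -/
theorem christoffelFirst_warpedModel (hh : DifferentiableAt ℝ h q.2) (h0 : h q.2 ≠ 0)
    (hγ : DifferentiableAt ℝ γ q.1) (v w : V × ℝ) :
    christoffelFirst (warpedModel h γ) q v w (0, 1) =
      -(deriv h q.2 / h q.2 * (warpedModel h γ q v w - v.2 * w.2)) := by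
  have hW := differentiableAt_warpedModel hh hγ
  -- Pairing with ∂/∂r gives the constant `w.2`. Only the r-derivative of `h²γ` survives, and `hh'γ
  -- = (h'/h)·h²γ`.
  have e1 : ∀ v w : V × ℝ, fderiv ℝ (warpedModel h γ) q v w (0, 1) = 0 := by
    intro v w
    rw [fderiv_bilinear_apply hW]
    simp [warpedModel_apply]
  have e2 : fderiv ℝ (warpedModel h γ) q (0, 1) v w =
      2 * h q.2 * deriv h q.2 * γ q.1 v.1 w.1 := by
    have hh' : HasFDerivAt h _ q.2 := hh.hasDerivAt.hasFDerivAt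
    have hc := ((((hh'.comp q hasFDerivAt_snd).pow 2).mul
      (((hγ.hasFDerivAt.comp q hasFDerivAt_fst).clm_apply (hasFDerivAt_const v.1 q)).clm_apply
        (hasFDerivAt_const w.1 q))).const_add (v.2 * w.2)).fderiv
    rw [fderiv_bilinear_apply hW]
    simp only [warpedModel_apply]
    simp only [Function.comp_def] at hc
    erw [hc]
    simp
    ring
  rw [christoffelFirst, e1, e1, e2, warpedModel_apply]
  field_simp
  ring

end WarpedModel

/-! ### The Hessian of the height in coordinates. -/

section Hypersurface

variable {V : Type*} [NormedAddCommGroup V] [NormedSpace ℝ V] [FiniteDimensional ℝ V]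

/-- A dimension count: `(a, s) ↦ A a + s ν` is an injective endomorphism of `V × ℝ`, hence onto, and
pairing with ν reads off s. -/
theorem exists_eq_tangent_add_normal {G : V × ℝ →L[ℝ] V × ℝ →L[ℝ] ℝ} {A : V →L[ℝ] V × ℝ}
    (hA : Function.Injective A) {ν : V × ℝ} (h1 : G ν ν = 1) (h0 : ∀ a, G ν (A a) = 0)
    (z : V × ℝ) : ∃ t, z = A t + G ν z • ν := by
  let L : V × ℝ →ₗ[ℝ] V × ℝ :=
    (A : V →ₗ[ℝ] V × ℝ).coprod (LinearMap.toSpanSingleton ℝ _ ν)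
  have hL : ∀ x, L x = A x.1 + x.2 • ν := fun x => rfl
  have hG : ∀ x, G ν (L x) = x.2 := fun x => by rw [hL, map_add, map_smul, h0, h1]; simp
  have hinj : Function.Injective L := by
    refine (injective_iff_map_eq_zero L).2 fun x hx => ?_
    have h2 : x.2 = 0 := by rw [← hG, hx, map_zero]
    rw [hL, h2, zero_smul, add_zero] at hx
    exact Prod.ext ((injective_iff_map_eq_zero A).1 hA _ hx) h2
  obtain ⟨x, hx⟩ := LinearMap.injective_iff_surjective.1 hinj z
  exact ⟨x.1, by rw [← hx, hG, hL]⟩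

/-- The equation for the Laplacian of the height of a hypersurface of a warped product,
in coordinates. -/
theorem traceWith_hessian_height {f : V → V × ℝ} {p : V} (hf : ContDiffAt ℝ 2 f p)
    {h : ℝ → ℝ} {γ : V → V →L[ℝ] V →L[ℝ] ℝ} (hh : DifferentiableAt ℝ h (f p).2)
    (h0 : h (f p).2 ≠ 0) (hγ : DifferentiableAt ℝ γ (f p).1)
    (hγs : ∀ v w, γ (f p).1 v w = γ (f p).1 w v) (hγ0 : ∀ v, v ≠ 0 → 0 < γ (f p).1 v v)
    {G : V × ℝ → V × ℝ →L[ℝ] V × ℝ →L[ℝ] ℝ} (hG : G =ᶠ[𝓝 (f p)] warpedModel h γ)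
    {g : V → V →L[ℝ] V →L[ℝ] ℝ}
    (hg : g =ᶠ[𝓝 p] fun y => (G (f y)).bilinearComp (fderiv ℝ f y) (fderiv ℝ f y))
    (hi : Function.Injective (fderiv ℝ f p)) {ν : V × ℝ} (hν : G (f p) ν ν = 1)
    (hνt : ∀ a, G (f p) ν (fderiv ℝ f p a) = 0) :
    traceWith (g p) (fun a b => fderiv ℝ (fderiv ℝ fun y => (f y).2) p a b -
        fderiv ℝ (fun y => (f y).2) p (christoffel g p a b)) =
      deriv h (f p).2 / h (f p).2 * ((Module.finrank ℝ V : ℝ) - 1 + ν.2 ^ 2) -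
        traceWith (g p) (fun a b => -(G (f p) (fderiv ℝ (fderiv ℝ f) p a b +
          christoffel G (f p) (fderiv ℝ f p a) (fderiv ℝ f p b)) ν)) * ν.2 := by
  have hf1 : DifferentiableAt ℝ f p := hf.differentiableAt (by norm_num)
  have hf2 : DifferentiableAt ℝ (fderiv ℝ f) p :=
    (hf.fderiv_right (m := 1) (by norm_num)).differentiableAt (by norm_num)
  have hGq : G (f p) = warpedModel h γ (f p) := hG.self_of_nhds
  have hGd : DifferentiableAt ℝ G (f p) :=
    (differentiableAt_warpedModel hh hγ).congr_of_eventuallyEq hG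
  have hGs : ∀ v w, G (f p) v w = G (f p) w v := by
    intro v w
    rw [hGq, warpedModel_apply, warpedModel_apply, hγs, mul_comm v.2]
  have hG0 : ∀ v, v ≠ 0 → 0 < G (f p) v v := by
    rintro ⟨v, r⟩ hv
    rw [hGq, warpedModel_apply]
    rcases eq_or_ne v 0 with rfl | hv'
    · have hr : r ≠ 0 := fun hr => hv (by rw [hr]; rfl)
      simpa using hr
    · have := mul_pos (pow_pos (abs_pos.2 h0) 2) (hγ0 v hv')
      rw [sq_abs] at this
      exact add_pos_of_nonneg_of_pos (mul_self_nonneg r) this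
  have hGr : ∀ z, G (f p) (0, 1) z = z.2 := by
    intro z
    rw [hGq, warpedModel_apply]
    simp
  have hgp : ∀ a b, g p a b = G (f p) (fderiv ℝ f p a) (fderiv ℝ f p b) := by
    intro a b
    rw [hg.self_of_nhds]
    rfl
  have hgs : ∀ v w, g p v w = g p w v := fun v w => by rw [hgp, hgp, hGs]
  have hg0 : ∀ v, v ≠ 0 → 0 < g p v v := fun v hv => by
    rw [hgp]
    exact hG0 _ fun h => hv ((injective_iff_map_eq_zero _).1 hi _ h)
  have hw : ∀ᶠ y in 𝓝 p, fderiv ℝ (fun y => (f y).2) y =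
      (ContinuousLinearMap.snd ℝ V ℝ).comp (fderiv ℝ f y) := by
    filter_upwards [hf.eventually (by simp)] with y hy
    exact ((ContinuousLinearMap.snd ℝ V ℝ).hasFDerivAt.comp y
      (hy.differentiableAt (by norm_num)).hasFDerivAt).fderiv
  have hw1 : ∀ a, fderiv ℝ (fun y => (f y).2) p a = (fderiv ℝ f p a).2 := fun a => by
    rw [hw.self_of_nhds]; rfl
  have hw2 : ∀ a b, fderiv ℝ (fderiv ℝ fun y => (f y).2) p a b =
      (fderiv ℝ (fderiv ℝ f) p a b).2 := by
    intro a b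
    rw [Filter.EventuallyEq.fderiv_eq hw,
      ((hasFDerivAt_const (ContinuousLinearMap.snd ℝ V ℝ) p).clm_comp hf2.hasFDerivAt).fderiv]
    simp
  -- The tangential part t of ∂/∂r is the gradient of the height; the normal coefficient is `Θ =
  -- ν.2`.
  obtain ⟨t, ht⟩ := exists_eq_tangent_add_normal hi hν hνt (0, 1)
  have hνr : G (f p) ν (0, 1) = ν.2 := by rw [hGs, hGr]
  rw [hνr] at ht
  have hgt : ∀ a, g p t a = (fderiv ℝ f p a).2 := by
    intro a
    rw [hgp, ← hGr, ht]
    simp [hνt]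
  -- The radial component of `ht` reads `1 = du(t) + Θ²`.
  have hgtt : g p t t = 1 - ν.2 ^ 2 := by
    have := congrArg Prod.snd ht
    rw [hgt]
    simp at this
    linarith
  -- Gauss formula: the induced connection is the tangential part of the ambient one. Both sides
  -- have the same pairing with every tangent vector, and g is definite.
  have hgauss : ∀ a b, fderiv ℝ f p (christoffel g p a b) = fderiv ℝ (fderiv ℝ f) p a b +
      christoffel G (f p) (fderiv ℝ f p a) (fderiv ℝ f p b) -
      G (f p) (fderiv ℝ (fderiv ℝ f) p a b +
          christoffel G (f p) (fderiv ℝ f p a) (fderiv ℝ f p b)) ν • ν := by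
    intro a b
    set Z := fderiv ℝ (fderiv ℝ f) p a b +
          christoffel G (f p) (fderiv ℝ f p a) (fderiv ℝ f p b) with hZ
    obtain ⟨s, hs⟩ := exists_eq_tangent_add_normal hi hν hνt Z
    have key : ∀ c, g p (christoffel g p a b) c = g p s c := by
      intro c
      rw [apply_christoffel hg0 hgs, christoffelFirst_congr hg,
        christoffelFirst_bilinearComp hf hGd hGs, ← apply_christoffel hG0 hGs,
        ← add_apply, ← map_add, ← hZ, hs, hgp]
      simp [hνt]
    have hs' : christoffel g p a b = s := by
      by_contra hne
      have := hg0 _ (sub_ne_zero.2 hne)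
      have hz : ∀ c, g p (christoffel g p a b - s) c = 0 := fun c => by
        rw [map_sub, sub_apply, key, sub_self]
      exact (this.trans_eq (hz _)).false
    rw [hs', hGs Z ν]
    exact eq_sub_of_add_eq hs.symm
  -- As r is a coordinate, the radial component of Γ is `-Hess r`.
  have hrad : ∀ a b, (christoffel G (f p) (fderiv ℝ f p a) (fderiv ℝ f p b)).2 =
      -(deriv h (f p).2 / h (f p).2 * (g p a b - g p t a * g p t b)) := by
    intro a b
    rw [← hGr, hGs, apply_christoffel hG0 hGs, christoffelFirst_congr hG,
      christoffelFirst_warpedModel hh h0 hγ, ← hGq, hgp, hgt, hgt]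
  have hess : ∀ a b, fderiv ℝ (fderiv ℝ fun y => (f y).2) p a b -
        fderiv ℝ (fun y => (f y).2) p (christoffel g p a b) =
      deriv h (f p).2 / h (f p).2 * (g p a b + (-1) * (g p t a * g p t b)) +
        (-ν.2) * -(G (f p) (fderiv ℝ (fderiv ℝ f) p a b +
          christoffel G (f p) (fderiv ℝ f p a) (fderiv ℝ f p b)) ν) := by
    intro a b
    rw [hw2, hw1, hgauss, Prod.snd_sub, Prod.snd_add, hrad]
    simp
    ring
  simp_rw [hess]
  rw [traceWith_add, traceWith_const_mul, traceWith_const_mul, traceWith_add,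
    traceWith_const_mul, traceWith_self hg0 hgs, traceWith_apply_mul_apply hg0 hgs, hgtt]
  ring

end Hypersurface

/-! ### Pullbacks of metrics and their expressions in charts. -/

section Pullback

variable {V : Type*} [NormedAddCommGroup V] [NormedSpace ℝ V]
  {H : Type*} [TopologicalSpace H] {I : ModelWithCorners ℝ V H}
  {W : Type*} [NormedAddCommGroup W] [NormedSpace ℝ W]
  {K : Type*} [TopologicalSpace K] {J : ModelWithCorners ℝ W K}
  {U : Type*} [NormedAddCommGroup U] [NormedSpace ℝ U]
  {L : Type*} [TopologicalSpace L] {I' : ModelWithCorners ℝ U L}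
  {X : Type*} [TopologicalSpace X] [ChartedSpace H X]
  {Y : Type*} [TopologicalSpace Y] [ChartedSpace K Y]
  {Z : Type*} [TopologicalSpace Z] [ChartedSpace L Z]

theorem pullback_apply (f : X → Y) (g : BilinField J Y) (x : X) (v w : TangentSpace I x) :
    pullback I J f g x v w = g (f x) (mfderiv I J f x v) (mfderiv I J f x w) := rfl

theorem pullback_eq {f : X → Y} {x : X} {A : V →L[ℝ] W} (g : BilinField J Y)
    (hA : HasMFDerivAt I J f x A) :
    pullback I J f g x =
      ContinuousLinearMap.bilinearComp (E := W) (F := W) (E' := V) (F' := V) (g (f x)) A A := by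
  obtain rfl : mfderiv I J f x = A := hA.mfderiv
  rfl

theorem pullback_comp {f : X → Y} {k : Y → Z} {x : X} (g : BilinField I' Z)
    (hk : MDifferentiableAt J I' k (f x)) (hf : MDifferentiableAt I J f x) :
    pullback I I' (k ∘ f) g x = pullback I J f (pullback J I' k g) x := by
  ext v w
  simp only [pullback_apply]
  rw [mfderiv_comp x hk hf]
  rfl

theorem pullback_congr {f f' : X → Y} {x : X} (g : BilinField J Y) (h : f =ᶠ[𝓝 x] f') :
    pullback I J f g x = pullback I J f' g x := by
  -- The tangent spaces at `f x` and `f' x` are different types; with differentials typed on the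
  -- model spaces, both equalities can be substituted.
  have key : ∀ (y y' : Y) (A A' : V →L[ℝ] W), y = y' → A = A' →
      ContinuousLinearMap.bilinearComp (E := W) (F := W) (E' := V) (F' := V) (g y) A A =
        ContinuousLinearMap.bilinearComp (E := W) (F := W) (E' := V) (F' := V) (g y') A' A' := by
    rintro y _ A _ rfl rfl
    rfl
  exact key _ _ _ _ h.self_of_nhds h.mfderiv_eq

theorem pullback_id (g : BilinField I X) (x : X) : pullback I I id g x = g x := by
  ext v w
  rw [pullback_apply, mfderiv_id]
  rfl

theorem pullback_modelSpace {f : V → W} (G : W → W →L[ℝ] W →L[ℝ] ℝ) {p : V}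
    (hf : DifferentiableAt ℝ f p) : pullback 𝓘(ℝ, V) 𝓘(ℝ, W) f G p =
      (G (f p)).bilinearComp (fderiv ℝ f p) (fderiv ℝ f p) :=
  pullback_eq (I := 𝓘(ℝ, V)) (J := 𝓘(ℝ, W)) G hf.hasFDerivAt.hasMFDerivAt

variable [I.Boundaryless] [IsManifold I 1 X] [J.Boundaryless] [IsManifold J 1 Y]

theorem mdifferentiableAt_extChartAt_symm {x : X} {z : V} (hz : z ∈ (extChartAt I x).target) :
    MDifferentiableAt 𝓘(ℝ, V) I (extChartAt I x).symm z := by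
  have := mdifferentiableWithinAt_extChartAt_symm hz
  rwa [I.range_eq_univ, mdifferentiableWithinAt_univ] at this

/-- The metric induced by `F`, in charts, is the pullback by `F` in charts. -/
theorem inChart_pullback {F : X → Y} (hF : MDifferentiable I J F) (g : BilinField J Y) (x : X) :
    inChart I (pullback I J F g) x =ᶠ[𝓝 (extChartAt I x x)] fun y =>
      (inChart J g (F x) ((extChartAt J (F x) ∘ F ∘ (extChartAt I x).symm) y)).bilinearComp
        (fderiv ℝ (extChartAt J (F x) ∘ F ∘ (extChartAt I x).symm) y)
        (fderiv ℝ (extChartAt J (F x) ∘ F ∘ (extChartAt I x).symm) y) := by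
  have hcont : ContinuousAt (F ∘ (extChartAt I x).symm) (extChartAt I x x) :=
    ContinuousAt.comp (hF.continuous.continuousAt) (continuousAt_extChartAt_symm x)
  have hsrc : ∀ᶠ y in 𝓝 (extChartAt I x x),
      (F ∘ (extChartAt I x).symm) y ∈ (extChartAt J (F x)).source := by
    refine hcont.eventually_mem ?_
    rw [Function.comp_apply, extChartAt_to_inv]
    exact extChartAt_source_mem_nhds (F x)
  filter_upwards [extChartAt_target_mem_nhds (I := I) x, hsrc.eventually_nhds] with y hy hy'
  have hd := mdifferentiableAt_extChartAt_symm hy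
  have hFd : MDifferentiableAt 𝓘(ℝ, V) J (F ∘ (extChartAt I x).symm) y :=
    (hF _).comp y hd
  have hys := hy'.self_of_nhds
  have hψ : MDifferentiableAt J 𝓘(ℝ, W) (extChartAt J (F x)) ((F ∘ (extChartAt I x).symm) y) :=
    mdifferentiableAt_extChartAt (by rwa [extChartAt_source] at hys)
  have hψ' : MDifferentiableAt 𝓘(ℝ, W) J (extChartAt J (F x)).symm
      ((extChartAt J (F x) ∘ F ∘ (extChartAt I x).symm) y) :=
    mdifferentiableAt_extChartAt_symm ((extChartAt J (F x)).map_source hys)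
  have h1 : inChart I (pullback I J F g) x y =
      pullback 𝓘(ℝ, V) J (F ∘ (extChartAt I x).symm) g y := (pullback_comp g (hF _) hd).symm
  -- Inserting the chart at `F x` and its inverse changes nothing near y, and exposes F in charts to
  -- the chain rule.
  have h2 : pullback 𝓘(ℝ, V) J (F ∘ (extChartAt I x).symm) g y =
      pullback 𝓘(ℝ, V) J ((extChartAt J (F x)).symm ∘
        (extChartAt J (F x) ∘ F ∘ (extChartAt I x).symm)) g y := by
    apply pullback_congr
    filter_upwards [hy'] with z hz
    exact ((extChartAt J (F x)).left_inv hz).symm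
  exact h1.trans (h2.trans ((pullback_comp g hψ' (hψ.comp y hFd)).trans
    (pullback_modelSpace _ (hψ.comp y hFd).differentiableAt)))

/-- The tangent space at x is identified with V through the preferred chart at x, whose derivative
there is therefore the identity. -/
theorem inChart_extChartAt_self (g : BilinField I X) (x : X) (v w : V) :
    inChart I g x (extChartAt I x x) v w = g x v w := by
  have h1 : pullback I I ((extChartAt I x).symm ∘ extChartAt I x) g x = g x := by
    rw [← pullback_id g x]
    apply pullback_congr
    filter_upwards [extChartAt_source_mem_nhds (I := I) x] with y hy
    exact (extChartAt I x).left_inv hy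
  rw [pullback_comp (J := 𝓘(ℝ, V)) g
    (mdifferentiableAt_extChartAt_symm (mem_extChartAt_target x))
    (mdifferentiableAt_extChartAt (mem_chart_source H x))] at h1
  have h2 := congrArg (fun B : V →L[ℝ] V →L[ℝ] ℝ => B v w) h1
  refine Eq.trans ?_ h2
  have hA : HasMFDerivAt I 𝓘(ℝ, V) (extChartAt I x) x (ContinuousLinearMap.id ℝ V) := by
    have := (mdifferentiableAt_extChartAt (I := I) (mem_chart_source H x)).hasMFDerivAt
    rwa [mfderiv_extChartAt_self] at this
  rw [pullback_eq _ hA]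
  rfl

omit [J.Boundaryless] [IsManifold I 1 X] [IsManifold J 1 Y] in
theorem fderiv_writtenInExtChartAt {F : X → Y} (hF : MDifferentiable I J F) (x : X) (v : V) :
    fderiv ℝ (extChartAt J (F x) ∘ F ∘ (extChartAt I x).symm) (extChartAt I x x) v =
      mfderiv I J F x v := by
  have := (hF x).mfderiv
  rw [this, I.range_eq_univ, fderivWithin_univ]
  rfl

/-- The coefficients of a smooth Riemannian metric in a chart are differentiable. -/
theorem differentiableAt_inChart {n : WithTop ℕ∞} (hn : n ≠ 0)
    (g : Bundle.ContMDiffRiemannianMetric I n V (fun y : X => TangentSpace I y)) (x : X) :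
    DifferentiableAt ℝ (inChart I g.inner x) (extChartAt I x x) := by
  have h1 := (Bundle.contMDiffAt_section x).1 (g.contMDiff x)
  have h2 := h1.mdifferentiableAt hn
  have hx : (extChartAt I x).symm (extChartAt I x x) = x := extChartAt_to_inv x
  rw [← hx] at h2
  have h3 := h2.comp _ (mdifferentiableAt_extChartAt_symm (mem_extChartAt_target x))
  have h4 := h3.differentiableAt
  refine h4.congr_of_eventuallyEq ?_
  filter_upwards [extChartAt_target_mem_nhds (I := I) x] with y hy
  have hys : (extChartAt I x).symm y ∈ (chartAt H x).source := by
    rw [← extChartAt_source I]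
    exact (extChartAt I x).map_target hy
  -- The inverse of the tangent bundle trivialization is the derivative of the inverse chart, so the
  -- coordinates of the section g are its chart coefficients.
  have hA : HasMFDerivAt 𝓘(ℝ, V) I (extChartAt I x).symm y
      ((trivializationAt V (TangentSpace I) x).symmL ℝ ((extChartAt I x).symm y)) := by
    have := (mdifferentiableAt_extChartAt_symm hy).hasMFDerivAt
    rwa [TangentBundle.symmL_trivializationAt hys, I.range_eq_univ, mfderivWithin_univ,
      (extChartAt I x).right_inv hy]
  ext v w
  rw [inChart, pullback_eq _ hA]
  have hb : (extChartAt I x).symm y ∈ (trivializationAt V (TangentSpace I) x).baseSet := hys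
  have h5 := inCoordinates_apply_eq₂ (𝕜 := ℝ) (F₁ := V) (E₁ := fun y : X => TangentSpace I y)
    (F₂ := V) (E₂ := fun y : X => TangentSpace I y) (F₃ := ℝ) (E₃ := Bundle.Trivial X ℝ)
    (ϕ := g.inner ((extChartAt I x).symm y)) (v := v) (w := w) hb hb (Set.mem_univ _)
  refine Eq.trans ?_ (Eq.trans h5.symm ?_)
  · have h6 : ∀ r : ℝ, (trivializationAt ℝ (Bundle.Trivial X ℝ) x).linearMapAt ℝ
        ((extChartAt I x).symm y) r = r :=
      fun r => LinearMap.congr_fun (Bundle.Trivial.linearMapAt_trivialization ℝ X ℝ _) r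
    have h7 : ∀ v, (trivializationAt V (TangentSpace I) x).symmL ℝ ((extChartAt I x).symm y) v =
        (trivializationAt V (TangentSpace I) x).symm ((extChartAt I x).symm y) v :=
      fun v => Bundle.Trivialization.symmL_apply _ hb v
    have h8 := h6 (g.inner ((extChartAt I x).symm y)
      ((trivializationAt V (TangentSpace I) x).symm ((extChartAt I x).symm y) v)
      ((trivializationAt V (TangentSpace I) x).symm ((extChartAt I x).symm y) w))
    refine Eq.trans ?_ h8.symm
    rw [← h7, ← h7]
    rfl
  · simp only [Function.comp_apply, extChartAt_to_inv]
    rfl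

end Pullback

/-! ### The warped metric in product charts. -/

section WarpedChart

variable {n : ℕ} {N : Type*} [TopologicalSpace N] [ChartedSpace (E n) N]
  [IsManifold 𝓘(ℝ, E n) ∞ N]
  (gN : Bundle.ContMDiffRiemannianMetric 𝓘(ℝ, E n) ∞ (E n)
    (fun y : N => TangentSpace 𝓘(ℝ, E n) y)) (h : ℝ → ℝ)

theorem warpedMetric_apply (p : N × ℝ) (v w : E n × ℝ) :
    warpedMetric gN h p v w = v.2 * w.2 + h p.2 ^ 2 * gN.inner p.1 v.1 w.1 := by
  rw [warpedMetric, pullback_eq (I := IM n) (J := 𝓘(ℝ, ℝ)) lineMetric (hasMFDerivAt_snd p),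
    pullback_eq (I := IM n) (J := 𝓘(ℝ, E n)) gN.inner (hasMFDerivAt_fst p)]
  rfl

/-- The product chart is a chart of N times the identity of ℝ, so both projections commute with it.
-/
theorem inChart_warpedMetric (x : N × ℝ) {q : E n × ℝ}
    (hq : q ∈ (extChartAt (IM n) x).target) :
    inChart (IM n) (warpedMetric gN h) x q =
      warpedModel h (inChart 𝓘(ℝ, E n) gN.inner x.1) q := by
  have hd := mdifferentiableAt_extChartAt_symm hq
  have hd1 : MDifferentiableAt 𝓘(ℝ, E n) 𝓘(ℝ, E n) (extChartAt 𝓘(ℝ, E n) x.1).symm q.1 := by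
    apply mdifferentiableAt_extChartAt_symm
    rw [extChartAt_prod] at hq
    exact hq.1
  have h1 : pullback 𝓘(ℝ, E n × ℝ) 𝓘(ℝ, ℝ) (Prod.snd ∘ (extChartAt (IM n) x).symm) lineMetric q =
      (ContinuousLinearMap.mul ℝ ℝ).bilinearComp (ContinuousLinearMap.snd ℝ (E n) ℝ)
        (ContinuousLinearMap.snd ℝ (E n) ℝ) :=
    pullback_eq (I := 𝓘(ℝ, E n × ℝ)) (J := 𝓘(ℝ, ℝ)) (f := Prod.snd) lineMetric
      hasFDerivAt_snd.hasMFDerivAt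
  have h2 : pullback 𝓘(ℝ, E n × ℝ) 𝓘(ℝ, E n) (Prod.fst ∘ (extChartAt (IM n) x).symm)
      gN.inner q = (inChart 𝓘(ℝ, E n) gN.inner x.1 q.1).bilinearComp
        (ContinuousLinearMap.fst ℝ (E n) ℝ) (ContinuousLinearMap.fst ℝ (E n) ℝ) :=
    (pullback_comp (I := 𝓘(ℝ, E n × ℝ)) (J := 𝓘(ℝ, E n)) (f := Prod.fst) gN.inner hd1
      differentiableAt_fst.mdifferentiableAt).trans
      (pullback_eq (I := 𝓘(ℝ, E n × ℝ)) (J := 𝓘(ℝ, E n)) (f := Prod.fst) _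
        hasFDerivAt_fst.hasMFDerivAt)
  rw [pullback_comp _ mdifferentiableAt_snd hd] at h1
  rw [pullback_comp _ mdifferentiableAt_fst hd] at h2
  rw [warpedModel, ← h1, ← h2]
  rfl

end WarpedChart

/-! ### The height equations on manifolds. -/

theorem isOpen_radialInterval (rbar : EReal) : IsOpen (radialInterval rbar) :=
  isOpen_Iio.preimage (continuous_coe_real_ereal.comp continuous_abs)

theorem uniqueDiffWithinAt_timeInterval {T : EReal} {t : ℝ} (ht : t ∈ timeInterval T) :
    UniqueDiffWithinAt ℝ (timeInterval T) t := by
  -- A real b between t and T puts t in `[0, b) ⊆ [0, T)`, which covers `T = ∞` and the endpoint `t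
  -- = 0` alike.
  obtain ⟨b, htb, hbT⟩ := EReal.lt_iff_exists_real_btwn.1 ht.2
  have htb' : t < b := EReal.coe_lt_coe_iff.1 htb
  refine (uniqueDiffOn_Ico 0 b t ⟨ht.1, htb'⟩).mono fun s hs => ⟨hs.1, ?_⟩
  exact (EReal.coe_lt_coe_iff.2 hs.2).trans hbT

section

variable {n : ℕ} {N : Type*} [TopologicalSpace N] [ChartedSpace (E n) N]
  [IsManifold 𝓘(ℝ, E n) ∞ N]
  {gN : Bundle.ContMDiffRiemannianMetric 𝓘(ℝ, E n) ∞ (E n)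
    (fun y : N => TangentSpace 𝓘(ℝ, E n) y)} {h : ℝ → ℝ} {rbar : EReal}
  {S : Type*} [TopologicalSpace S] [ChartedSpace (E n) S]

omit [TopologicalSpace S] [ChartedSpace (E n) S] in
theorem angle_warpedMetric (F : S → N × ℝ) (ν : ∀ x, TangentSpace (IM n) (F x)) (x : S) :
    angle (warpedMetric gN h) F ν x = (show E n × ℝ from ν x).2 := by
  refine (warpedMetric_apply gN h (F x) ((0 : E n), (1 : ℝ)) (ν x)).trans ?_
  have : gN.inner (F x).1 (0 : E n) = 0 := map_zero (gN.inner (F x).1)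
  rw [this]
  change 1 * (show E n × ℝ from ν x).2 + h (F x).2 ^ 2 * 0 = _
  ring

theorem laplacian_height [IsManifold 𝓘(ℝ, E n) ∞ S] (hn : 1 ≤ n)
    (h_smooth : ContDiffOn ℝ ∞ h (radialInterval rbar))
    (h_pos : ∀ r ∈ radialInterval rbar, 0 < h r)
    {F : S → N × ℝ} {ν : ∀ x, TangentSpace (IM n) (F x)} (hF : IsHypersurface (n := n) rbar F)
    (hν : IsUnitNormal 𝓘(ℝ, E n) (IM n) (warpedMetric gN h) F ν) (x : S) :
    laplacian 𝓘(ℝ, E n) (pullback 𝓘(ℝ, E n) (IM n) F (warpedMetric gN h)) (height F) x =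
      deriv h (height F x) / h (height F x) *
          ((n : ℝ) - 2 + angle (warpedMetric gN h) F ν x ^ 2) -
        meanCurvature 𝓘(ℝ, E n) (IM n) (warpedMetric gN h) F x (ν x) *
          angle (warpedMetric gN h) F ν x := by
  have : IsManifold 𝓘(ℝ, E n) 1 S := IsManifold.of_le (n := ∞) (by simp)
  have : IsManifold 𝓘(ℝ, E n) 1 N := IsManifold.of_le (n := ∞) (by simp)
  have hFd : MDifferentiable 𝓘(ℝ, E n) (IM n) F := hF.smooth.mdifferentiable (by simp)
  set p : E n := extChartAt 𝓘(ℝ, E n) x x with hp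
  set f : E n → E n × ℝ := extChartAt (IM n) (F x) ∘ F ∘ (extChartAt 𝓘(ℝ, E n) x).symm with hf
  have hfp : f p = extChartAt (IM n) (F x) (F x) := by
    simp only [hf, hp, Function.comp_apply, extChartAt_to_inv]
  have hfp2 : (f p).2 = (F x).2 := by rw [hfp]; rfl
  have hfp1 : (f p).1 = extChartAt 𝓘(ℝ, E n) (F x).1 (F x).1 := by rw [hfp]; rfl
  have hfs : ContDiffAt ℝ 2 f p := by
    have := (contMDiffAt_iff.1 (hF.smooth x)).2
    rw [ModelWithCorners.range_eq_univ, contDiffWithinAt_univ] at this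
    exact this.of_le (WithTop.coe_le_coe.2 le_top)
  have hDf : ∀ a, fderiv ℝ f p a = mfderiv 𝓘(ℝ, E n) (IM n) F x a :=
    fderiv_writtenInExtChartAt hFd x
  have hG : inChart (IM n) (warpedMetric gN h) (F x) =ᶠ[𝓝 (f p)]
      warpedModel h (inChart 𝓘(ℝ, E n) gN.inner (F x).1) := by
    rw [hfp]
    filter_upwards [extChartAt_target_mem_nhds (I := IM n) (F x)] with q hq
    exact inChart_warpedMetric gN h (F x) hq
  have hGself : ∀ v w : E n × ℝ, inChart (IM n) (warpedMetric gN h) (F x) (f p) v w =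
      warpedMetric gN h (F x) v w := by
    rw [hfp]
    exact inChart_extChartAt_self _ _
  have hγself : ∀ v w : E n, inChart 𝓘(ℝ, E n) gN.inner (F x).1 (f p).1 v w =
      gN.inner (F x).1 v w := by
    rw [hfp1]
    exact inChart_extChartAt_self _ _
  have hrad : (f p).2 ∈ radialInterval rbar := hfp2 ▸ hF.mem x
  have key := traceWith_hessian_height (f := f) (p := p) hfs (h := h)
    (γ := inChart 𝓘(ℝ, E n) gN.inner (F x).1)
    (((h_smooth.contDiffAt ((isOpen_radialInterval rbar).mem_nhds hrad))).differentiableAt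
      (by simp)) (h_pos _ hrad).ne'
    (by rw [hfp1]; exact differentiableAt_inChart (by simp) gN _)
    (fun v w => by rw [hγself, hγself]; exact gN.symm _ _ _)
    (fun v hv => by rw [hγself]; exact gN.pos _ _ hv)
    hG (inChart_pullback hFd (warpedMetric gN h) x)
    (fun a b hab => hF.immersion x (by rw [← hDf, ← hDf]; exact hab))
    (ν := ν x) ((hGself _ _).trans (hν x).1)
    (fun a => by
      rw [hDf]
      exact (hGself _ _).trans ((hν x).2 a))
  have hn' : mfderiv (IM n) 𝓘(ℝ, E n × ℝ) (extChartAt (IM n) (F x)) (F x) (ν x) = ν x := by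
    rw [mfderiv_extChartAt_self]
    rfl
  have hfin : ((Module.finrank ℝ (E n) : ℕ) : ℝ) - 1 = (n : ℝ) - 2 := by
    rw [finrank_euclideanSpace_fin, Nat.cast_sub hn]
    push_cast
    ring
  rw [hfin, hfp2] at key
  have hA : secondFundamentalForm 𝓘(ℝ, E n) (IM n) (warpedMetric gN h) F x (ν x) =
      fun a b => -(inChart (IM n) (warpedMetric gN h) (F x) (f p)
        (fderiv ℝ (fderiv ℝ f) p a b + christoffel (inChart (IM n) (warpedMetric gN h) (F x)) (f p)
          (fderiv ℝ f p a) (fderiv ℝ f p b)) (ν x)) := by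
    -- The base point and the normal in the chart are generalized so that both can be substituted at
    -- once.
    have : ∀ q m : E n × ℝ, q = f p → m = ν x →
        (fun a b => -(inChart (IM n) (warpedMetric gN h) (F x) q
          (fderiv ℝ (fderiv ℝ f) p a b + christoffel (inChart (IM n) (warpedMetric gN h) (F x)) q
            (fderiv ℝ f p a) (fderiv ℝ f p b)) m)) =
        fun a b => -(inChart (IM n) (warpedMetric gN h) (F x) (f p)
          (fderiv ℝ (fderiv ℝ f) p a b + christoffel (inChart (IM n) (warpedMetric gN h) (F x))
            (f p) (fderiv ℝ f p a) (fderiv ℝ f p b)) (ν x)) := by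
      rintro _ _ rfl rfl
      rfl
    exact this _ _ hfp.symm hn'
  rw [angle_warpedMetric, meanCurvature, hA]
  exact key

/-- Chain rule with the projection to ℝ: the radial component of `-Hν` is `-HΘ` by
`angle_warpedMetric`. -/
theorem hasDerivWithinAt_height {T : EReal} {F : ℝ → S → N × ℝ}
    {ν : ∀ t x, TangentSpace (IM n) (F t x)}
    (hF : IsMeanCurvatureFlow rbar (warpedMetric gN h) T F ν) {t : ℝ}
    (ht : t ∈ timeInterval T) (x : S) :
    HasDerivWithinAt (fun s => height (F s) x)
      (-(meanCurvature 𝓘(ℝ, E n) (IM n) (warpedMetric gN h) (F t) x (ν t x)) *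
        angle (warpedMetric gN h) (F t) (ν t) x) (timeInterval T) t := by
  have h1 := (hasMFDerivAt_snd (I := 𝓘(ℝ, E n)) (I' := 𝓘(ℝ, ℝ)) (F t x)).comp_hasMFDerivWithinAt t
    (hF.evolution t ht x)
  have h2 : HasMFDerivWithinAt 𝓘(ℝ, ℝ) 𝓘(ℝ, ℝ) (fun s => height (F s) x) (timeInterval T) t
      ((ContinuousLinearMap.snd ℝ (E n) ℝ).comp (ContinuousLinearMap.toSpanSingleton ℝ
        ((-(meanCurvature 𝓘(ℝ, E n) (IM n) (warpedMetric gN h) (F t) x (ν t x)) • ν t x :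
          TangentSpace (IM n) (F t x)) : E n × ℝ))) := h1
  have h3 : ∀ L : ℝ →L[ℝ] ℝ, HasMFDerivWithinAt 𝓘(ℝ, ℝ) 𝓘(ℝ, ℝ) (fun s => height (F s) x)
      (timeInterval T) t L →
      HasDerivWithinAt (fun s => height (F s) x) (L 1) (timeInterval T) t :=
    fun L hL => HasFDerivWithinAt.hasDerivWithinAt hL.hasFDerivWithinAt
  rw [angle_warpedMetric]
  refine (h3 _ h2).congr_deriv ?_
  change ((1 : ℝ) • ((-(meanCurvature 𝓘(ℝ, E n) (IM n) (warpedMetric gN h) (F t) x (ν t x)) •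
    ν t x : TangentSpace (IM n) (F t x)) : E n × ℝ)).2 = _
  rw [one_smul]
  rfl

end

end WarpedFlow

theorem proposition2p4 (n : ℕ) (hn : 3 ≤ n)
    {N : Type*} [TopologicalSpace N] [ChartedSpace (WarpedFlow.E n) N]
    [IsManifold 𝓘(ℝ, WarpedFlow.E n) ∞ N]
    (gN : Bundle.ContMDiffRiemannianMetric 𝓘(ℝ, WarpedFlow.E n) ∞ (WarpedFlow.E n)
      (fun y : N => TangentSpace 𝓘(ℝ, WarpedFlow.E n) y))
    (rbar : EReal) (rbar_pos : 0 < rbar) (h : ℝ → ℝ)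
    (h_smooth : ContDiffOn ℝ ∞ h (WarpedFlow.radialInterval rbar))
    (h_pos : ∀ r ∈ WarpedFlow.radialInterval rbar, 0 < h r)
    {S : Type*} [TopologicalSpace S] [ChartedSpace (WarpedFlow.E n) S]
    [IsManifold 𝓘(ℝ, WarpedFlow.E n) ∞ S] :
    -- the elliptic equation for the height function of a hypersurface
    (∀ (F : S → N × ℝ) (ν : ∀ x, TangentSpace (WarpedFlow.IM n) (F x)),
      WarpedFlow.IsHypersurface (n := n) rbar F →
      WarpedFlow.IsUnitNormal 𝓘(ℝ, WarpedFlow.E n) (WarpedFlow.IM n)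
        (WarpedFlow.warpedMetric gN h) F ν →
      ∀ x : S,
        WarpedFlow.laplacian 𝓘(ℝ, WarpedFlow.E n)
            (WarpedFlow.pullback 𝓘(ℝ, WarpedFlow.E n) (WarpedFlow.IM n) F
              (WarpedFlow.warpedMetric gN h))
            (WarpedFlow.height F) x =
          deriv h (WarpedFlow.height F x) / h (WarpedFlow.height F x) *
              ((n : ℝ) - 2 + WarpedFlow.angle (WarpedFlow.warpedMetric gN h) F ν x ^ 2) -
            WarpedFlow.meanCurvature 𝓘(ℝ, WarpedFlow.E n) (WarpedFlow.IM n)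
                (WarpedFlow.warpedMetric gN h) F x (ν x) *
              WarpedFlow.angle (WarpedFlow.warpedMetric gN h) F ν x) ∧
    -- the evolution equations for the height function along the flow
    (∀ (T : EReal) (F : ℝ → S → N × ℝ) (ν : ∀ t x, TangentSpace (WarpedFlow.IM n) (F t x)),
      WarpedFlow.IsMeanCurvatureFlow rbar (WarpedFlow.warpedMetric gN h) T F ν →
      ∀ t ∈ WarpedFlow.timeInterval T, ∀ x : S,
        DifferentiableWithinAt ℝ (fun s => WarpedFlow.height (F s) x)
          (WarpedFlow.timeInterval T) t ∧
        derivWithin (fun s => WarpedFlow.height (F s) x) (WarpedFlow.timeInterval T) t =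
          -(WarpedFlow.meanCurvature 𝓘(ℝ, WarpedFlow.E n) (WarpedFlow.IM n)
              (WarpedFlow.warpedMetric gN h) (F t) x (ν t x)) *
            WarpedFlow.angle (WarpedFlow.warpedMetric gN h) (F t) (ν t) x ∧
        derivWithin (fun s => WarpedFlow.height (F s) x) (WarpedFlow.timeInterval T) t -
            WarpedFlow.laplacian 𝓘(ℝ, WarpedFlow.E n)
              (WarpedFlow.pullback 𝓘(ℝ, WarpedFlow.E n) (WarpedFlow.IM n) (F t)
                (WarpedFlow.warpedMetric gN h))
              (WarpedFlow.height (F t)) x =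
          -(deriv h (WarpedFlow.height (F t) x) / h (WarpedFlow.height (F t) x)) *
            ((n : ℝ) - 2 +
              WarpedFlow.angle (WarpedFlow.warpedMetric gN h) (F t) (ν t) x ^ 2)) := by
  refine ⟨fun F ν hF hν x =>
    WarpedFlow.laplacian_height (by omega) h_smooth h_pos hF hν x, fun T F ν hF t ht x => ?_⟩
  have hd := WarpedFlow.hasDerivWithinAt_height hF ht x
  have hd' := hd.derivWithin (WarpedFlow.uniqueDiffWithinAt_timeInterval ht)
  refine ⟨hd.differentiableWithinAt, hd', ?_⟩
  rw [hd', WarpedFlow.laplacian_height (by omega) h_smooth h_pos (hF.hypersurface t ht)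
    (hF.normal t ht) x]
  ring
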